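/- Let $\mathsf{E\text{-}PA}^{\omega}$ be classical extensional Peano arithmetic in all finite types (the types generated from $0$ by $\sigma\to\tau$, without product types): classical many-sorted predicate logic over the terms built by application from variables and the constants $0$, $S$, the combinators $\Pi_{\sigma,\tau}$, $\Sigma_{\rho,\sigma,\tau}$ and the (simultaneous) recursors in all finite types, with equality $=_0$ of natural numbers as the only primitive relation and equality at higher types defined extensionally; its axioms are the equality axioms for $=_0$, the extensionality axioms $x=_\sigma y\to zx=_\tau zy$, the successor axioms, the induction scheme for all formulas, and the defining equations of the combinators and recursors. Every natural number is regarded as the code of a finite sequence of natural numbers (with the sequence operations given by terms of Gödel's $T$), and $y\in s$ expresses that $y$ is one of the components of the sequence coded by $s$. Then there is a formula $\varphi(x^0,y^0)$ of the language of $\mathsf{E\text{-}PA}^{\omega}$, with no free variables other than $x$ and $y$ (both of type $0$), such that \[ \mathsf{E\text{-}PA}^{\omega}\not\vdash\ \forall x^{0}\,\exists y^{0}\,\varphi(x,y)\ \to\ \exists f^{0\to 0}\,\forall x^{0}\,\exists y^0\,\bigl(y\in f(x)\wedge\varphi(x,y)\bigr). \] -/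

import Mathlib

/-!
# The system E-PA^ω

Classical extensional Peano arithmetic in all finite types, without product types, with equality
of type `0` as the only primitive relation and with (simultaneous) recursors in all finite types.
Terms and formulas are intrinsically typed; variables are typed de Bruijn indices.
-/

namespace EPAomega

/-- The finite types: `0` (the type of natural numbers) and `σ → τ`. -/
inductive FType : Type
  | nat : FType
  | arrow : FType → FType → FType

infixr:60 " ↣ " => FType.arrow

/-- A context: the list of the types of the variables that may occur free. -/
abbrev Ctx : Type := List FType

/-- `Var Γ σ`: the variables (positions) of type `σ` in `Γ`. -/
inductive Var : Ctx → FType → Type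
  | here {Γ : Ctx} {σ : FType} : Var (σ :: Γ) σ
  | there {Γ : Ctx} {σ τ : FType} : Var Γ σ → Var (τ :: Γ) σ

/-- `arrows F [ρ₁, …, ρₖ] τ` is the type `F ρ₁ → … → F ρₖ → τ`. -/
def arrows (F : FType → FType) : List FType → FType → FType
  | [], τ => τ
  | ρ :: ρs, τ => F ρ ↣ arrows F ρs τ

/-- The type `ρ₁ → … → ρₖ → 0 → σ` of a step function of a simultaneous recursion. -/
abbrev stepType (ρs : List FType) (σ : FType) : FType :=
  arrows (fun ρ => ρ) ρs (.nat ↣ σ)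

/-- The type of a component, with values of type `τ`, of the simultaneous recursor for
`ρ₁, …, ρₖ`: its arguments are a number, `k` initial values and `k` step functions. -/
abbrev recType (ρs : List FType) (τ : FType) : FType :=
  .nat ↣ arrows (fun ρ => ρ) ρs (arrows (stepType ρs) ρs τ)

/-- Terms of type `σ` with free variables in `Γ`: variables, the constants `0`, `S`,
the combinators `Π` and `Σ`, the simultaneous recursors, and application. -/
inductive Term (Γ : Ctx) : FType → Type
  | var {σ : FType} : Var Γ σ → Term Γ σ
  | zero : Term Γ .nat
  | succ : Term Γ (.nat ↣ .nat)
  | combK (σ τ : FType) : Term Γ (σ ↣ τ ↣ σ)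
  | combS (ρ σ τ : FType) : Term Γ ((ρ ↣ σ ↣ τ) ↣ (ρ ↣ σ) ↣ ρ ↣ τ)
  | recursor (ρs : List FType) {τ : FType} (i : Var ρs τ) : Term Γ (recType ρs τ)
  | app {σ τ : FType} : Term Γ (σ ↣ τ) → Term Γ σ → Term Γ τ

/-- Formulas with free variables in `Γ`. The only prime formulas are `⊥` and equations between
terms of type `0`. -/
inductive Fml : Ctx → Type
  | eq {Γ : Ctx} : Term Γ .nat → Term Γ .nat → Fml Γ
  | bot {Γ : Ctx} : Fml Γ
  | and {Γ : Ctx} : Fml Γ → Fml Γ → Fml Γ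
  | or {Γ : Ctx} : Fml Γ → Fml Γ → Fml Γ
  | imp {Γ : Ctx} : Fml Γ → Fml Γ → Fml Γ
  | all {Γ : Ctx} (σ : FType) : Fml (σ :: Γ) → Fml Γ
  | ex {Γ : Ctx} (σ : FType) : Fml (σ :: Γ) → Fml Γ

/-- Negation `¬ φ` is `φ → ⊥`. -/
def Fml.neg {Γ : Ctx} (φ : Fml Γ) : Fml Γ := φ.imp .bot

/-! ### Substitution -/

/-- A simultaneous substitution of terms over `Δ` for the variables of `Γ`. -/
abbrev Sub (Γ Δ : Ctx) : Type := ∀ σ : FType, Var Γ σ → Term Δ σ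

def Term.subst {Γ Δ : Ctx} (s : Sub Γ Δ) : {σ : FType} → Term Γ σ → Term Δ σ
  | _, .var v => s _ v
  | _, .zero => .zero
  | _, .succ => .succ
  | _, .combK σ τ => .combK σ τ
  | _, .combS ρ σ τ => .combS ρ σ τ
  | _, .recursor ρs i => .recursor ρs i
  | _, .app t u => .app (t.subst s) (u.subst s)

/-- Weakening substitution: regard something over `Γ` as over `τ :: Γ`. -/
def Sub.shift (Γ : Ctx) (τ : FType) : Sub Γ (τ :: Γ) := fun _ v => .var (.there v)

def Term.wk {Γ : Ctx} {σ : FType} (τ : FType) (t : Term Γ σ) : Term (τ :: Γ) σ :=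
  t.subst (Sub.shift Γ τ)

/-- Extend a substitution by a term for the most recent variable. -/
def Sub.cons {Γ Δ : Ctx} {τ : FType} (t : Term Δ τ) (s : Sub Γ Δ) : Sub (τ :: Γ) Δ
  | _, .here => t
  | _, .there v => s _ v

/-- The substitution for the empty context. -/
def Sub.nil (Δ : Ctx) : Sub [] Δ := fun _ v => nomatch v

/-- Push a substitution under a binder of type `τ`. -/
def Sub.lift {Γ Δ : Ctx} (τ : FType) (s : Sub Γ Δ) : Sub (τ :: Γ) (τ :: Δ) :=
  Sub.cons (.var .here) (fun _ v => (s _ v).wk τ)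

def Fml.subst : {Γ Δ : Ctx} → Sub Γ Δ → Fml Γ → Fml Δ
  | _, _, s, .eq t u => .eq (t.subst s) (u.subst s)
  | _, _, _, .bot => .bot
  | _, _, s, .and φ ψ => .and (φ.subst s) (ψ.subst s)
  | _, _, s, .or φ ψ => .or (φ.subst s) (ψ.subst s)
  | _, _, s, .imp φ ψ => .imp (φ.subst s) (ψ.subst s)
  | _, _, s, .all σ φ => .all σ (φ.subst (s.lift σ))
  | _, _, s, .ex σ φ => .ex σ (φ.subst (s.lift σ))

def Fml.wk {Γ : Ctx} (τ : FType) (φ : Fml Γ) : Fml (τ :: Γ) := φ.subst (Sub.shift Γ τ)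

/-- `φ.inst t` is `φ(t)`: the term `t` is substituted for the most recent variable. -/
def Fml.inst {Γ : Ctx} {τ : FType} (φ : Fml (τ :: Γ)) (t : Term Γ τ) : Fml Γ :=
  φ.subst (Sub.cons t (fun _ v => .var v))

/-- `φ(S x)`, for `φ(x)` with most recent variable `x` of type `0`. -/
def Fml.instSucc {Γ : Ctx} (φ : Fml (.nat :: Γ)) : Fml (.nat :: Γ) :=
  φ.subst (Sub.cons (.app .succ (.var .here)) (Sub.shift Γ .nat))

/-! ### The axioms and derivability -/

/-- Extensional equality in all finite types:
`s =_{σ₁ → … → σₖ → 0} t` is `∀ x₁ … xₖ, s x₁ … xₖ =₀ t x₁ … xₖ`. -/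
def eqAt : {Γ : Ctx} → (τ : FType) → Term Γ τ → Term Γ τ → Fml Γ
  | _, .nat, s, t => .eq s t
  | _, .arrow σ τ, s, t => .all σ (eqAt τ (.app (s.wk σ) (.var .here)) (.app (t.wk σ) (.var .here)))

/-- Apply a term to a tuple of terms (indexed by the positions in `ρs`). -/
def appMany {Γ : Ctx} {F : FType → FType} {τ : FType} : (ρs : List FType) →
    Term Γ (arrows F ρs τ) → (∀ σ : FType, Var ρs σ → Term Γ (F σ)) → Term Γ τ
  | [], t, _ => t
  | _ :: ρs, t, u => appMany ρs (.app t (u _ .here)) (fun σ v => u σ (.there v))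

/-- `R_i x y z`: component `i` of the simultaneous recursion at `x`, with initial values `y` and
step functions `z`. -/
def recApp {Γ : Ctx} {ρs : List FType} {τ : FType} (i : Var ρs τ) (x : Term Γ .nat)
    (y : ∀ σ : FType, Var ρs σ → Term Γ σ)
    (z : ∀ σ : FType, Var ρs σ → Term Γ (stepType ρs σ)) : Term Γ τ :=
  appMany (F := stepType ρs) ρs
    (appMany (F := fun ρ => ρ) ρs (.app (.recursor ρs i) x) y) z

/-- The non-logical axioms of E-PA^ω. -/
inductive Ax : {Γ : Ctx} → Fml Γ → Prop
  | eq_refl {Γ : Ctx} (t : Term Γ .nat) : Ax (.eq t t)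
  | eq_symm {Γ : Ctx} (s t : Term Γ .nat) : Ax ((Fml.eq s t).imp (.eq t s))
  | eq_trans {Γ : Ctx} (s t u : Term Γ .nat) :
      Ax (((Fml.eq s t).and (.eq t u)).imp (.eq s u))
  /-- Extensionality: extensional equality is a congruence. -/
  | ext {Γ : Ctx} {σ τ : FType} (z : Term Γ (σ ↣ τ)) (x y : Term Γ σ) :
      Ax ((eqAt σ x y).imp (eqAt τ (.app z x) (.app z y)))
  | succ_ne_zero {Γ : Ctx} (t : Term Γ .nat) : Ax (Fml.neg (.eq (.app .succ t) .zero))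
  | succ_inj {Γ : Ctx} (s t : Term Γ .nat) :
      Ax ((Fml.eq (.app .succ s) (.app .succ t)).imp (.eq s t))
  /-- Induction, for every formula of the language (with parameters). -/
  | induction {Γ : Ctx} (φ : Fml (.nat :: Γ)) :
      Ax (((φ.inst .zero).and (.all .nat (φ.imp φ.instSucc))).imp (.all .nat φ))
  | combK {Γ : Ctx} {σ τ : FType} (x : Term Γ σ) (y : Term Γ τ) :
      Ax (eqAt σ (.app (.app (.combK σ τ) x) y) x)
  | combS {Γ : Ctx} {ρ σ τ : FType} (x : Term Γ (ρ ↣ σ ↣ τ)) (y : Term Γ (ρ ↣ σ)) (z : Term Γ ρ) :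
      Ax (eqAt τ (.app (.app (.app (.combS ρ σ τ) x) y) z) (.app (.app x z) (.app y z)))
  /-- `R_i 0 y z = y_i`. -/
  | rec_zero {Γ : Ctx} {ρs : List FType} {τ : FType} (i : Var ρs τ)
      (y : ∀ σ : FType, Var ρs σ → Term Γ σ)
      (z : ∀ σ : FType, Var ρs σ → Term Γ (stepType ρs σ)) :
      Ax (eqAt τ (recApp i .zero y z) (y τ i))
  /-- `R_i (S x) y z = z_i (R_1 x y z) … (R_k x y z) x`. -/
  | rec_succ {Γ : Ctx} {ρs : List FType} {τ : FType} (i : Var ρs τ) (x : Term Γ .nat)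
      (y : ∀ σ : FType, Var ρs σ → Term Γ σ)
      (z : ∀ σ : FType, Var ρs σ → Term Γ (stepType ρs σ)) :
      Ax (eqAt τ (recApp i (.app .succ x) y z)
        (.app (appMany (F := fun ρ => ρ) ρs (z τ i) (fun _ j => recApp j x y z)) x))

/-- `Derives H φ`: the formula `φ` is derivable in E-PA^ω from the hypotheses `H` (natural deduction
for classical many-sorted predicate logic, plus the axioms `Ax`). -/
inductive Derives : {Γ : Ctx} → List (Fml Γ) → Fml Γ → Prop
  | ax {Γ : Ctx} {H : List (Fml Γ)} {φ : Fml Γ} : Ax φ → Derives H φ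
  | hyp {Γ : Ctx} {H : List (Fml Γ)} {φ : Fml Γ} : φ ∈ H → Derives H φ
  | botE {Γ : Ctx} {H : List (Fml Γ)} {φ : Fml Γ} : Derives H .bot → Derives H φ
  | em {Γ : Ctx} {H : List (Fml Γ)} (φ : Fml Γ) : Derives H (φ.or φ.neg)
  | andI {Γ : Ctx} {H : List (Fml Γ)} {φ ψ : Fml Γ} :
      Derives H φ → Derives H ψ → Derives H (φ.and ψ)
  | andE₁ {Γ : Ctx} {H : List (Fml Γ)} {φ ψ : Fml Γ} : Derives H (φ.and ψ) → Derives H φ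
  | andE₂ {Γ : Ctx} {H : List (Fml Γ)} {φ ψ : Fml Γ} : Derives H (φ.and ψ) → Derives H ψ
  | orI₁ {Γ : Ctx} {H : List (Fml Γ)} {φ ψ : Fml Γ} : Derives H φ → Derives H (φ.or ψ)
  | orI₂ {Γ : Ctx} {H : List (Fml Γ)} {φ ψ : Fml Γ} : Derives H ψ → Derives H (φ.or ψ)
  | orE {Γ : Ctx} {H : List (Fml Γ)} {φ ψ χ : Fml Γ} :
      Derives H (φ.or ψ) → Derives (φ :: H) χ → Derives (ψ :: H) χ → Derives H χ
  | impI {Γ : Ctx} {H : List (Fml Γ)} {φ ψ : Fml Γ} : Derives (φ :: H) ψ → Derives H (φ.imp ψ)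
  | impE {Γ : Ctx} {H : List (Fml Γ)} {φ ψ : Fml Γ} :
      Derives H (φ.imp ψ) → Derives H φ → Derives H ψ
  | allI {Γ : Ctx} {H : List (Fml Γ)} {σ : FType} {φ : Fml (σ :: Γ)} :
      Derives (H.map (Fml.wk σ)) φ → Derives H (.all σ φ)
  | allE {Γ : Ctx} {H : List (Fml Γ)} {σ : FType} {φ : Fml (σ :: Γ)} (t : Term Γ σ) :
      Derives H (.all σ φ) → Derives H (φ.inst t)
  | exI {Γ : Ctx} {H : List (Fml Γ)} {σ : FType} {φ : Fml (σ :: Γ)} (t : Term Γ σ) :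
      Derives H (φ.inst t) → Derives H (.ex σ φ)
  | exE {Γ : Ctx} {H : List (Fml Γ)} {σ : FType} {φ : Fml (σ :: Γ)} {ψ : Fml Γ} :
      Derives H (.ex σ φ) → Derives (φ :: H.map (Fml.wk σ)) (ψ.wk σ) → Derives H ψ

/-- Provability of a sentence in E-PA^ω. -/
def Provable (φ : Fml []) : Prop := Derives [] φ

/-! ### Finite sequences of numbers, coded as numbers

Every number codes exactly one finite sequence: `0` codes the empty sequence, and `p + 1` codes the
sequence whose head is the first component of the pair coded by `p` and whose tail is the sequence
coded by its second component. Pairs are coded by Cantor's bijection `(a, b) ↦ (a+b)(a+b+1)/2 + b`.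
-/

/-- Abstraction `λ x. t`, defined through the combinators. -/
def Term.lam {Γ : Ctx} {σ : FType} : {τ : FType} → Term (σ :: Γ) τ → Term Γ (σ ↣ τ)
  | _, .var .here => .app (.app (.combS σ (σ ↣ σ) σ) (.combK σ (σ ↣ σ))) (.combK σ σ)
  | _, .var (.there v) => .app (.combK _ _) (.var v)
  | _, .zero => .app (.combK _ _) .zero
  | _, .succ => .app (.combK _ _) .succ
  | _, .combK α β => .app (.combK _ _) (.combK α β)
  | _, .combS α β γ => .app (.combK _ _) (.combS α β γ)
  | _, .recursor ρs i => .app (.combK _ _) (.recursor ρs i)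
  | _, .app t u => .app (.app (.combS _ _ _) t.lam) u.lam

/-- Primitive recursion into type `0`: `R 0 y z = y` and `R (S x) y z = z (R x y z) x`. -/
def natRec {Γ : Ctx} (x y : Term Γ .nat) (z : Term Γ (.nat ↣ .nat ↣ .nat)) : Term Γ .nat :=
  .app (.app (.app (.recursor [.nat] .here) x) y) z

/-- The predecessor, with value `0` at `0`. -/
def pred {Γ : Ctx} (x : Term Γ .nat) : Term Γ .nat :=
  natRec x .zero (.lam (.lam (.var .here)))

/-- `a` if `x = 0`, and `b` otherwise. -/
def cond {Γ : Ctx} (x a b : Term Γ .nat) : Term Γ .nat :=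
  natRec x a (.lam (.lam ((b.wk .nat).wk .nat)))

/-- Step function `λ a b n. if a = 0 then b + 1 else a - 1`. -/
def unpairStep₁ {Γ : Ctx} : Term Γ (.nat ↣ .nat ↣ .nat ↣ .nat) :=
  .lam (.lam (.lam (cond (.var (.there (.there .here)))
    (.app .succ (.var (.there .here))) (pred (.var (.there (.there .here)))))))

/-- Step function `λ a b n. if a = 0 then 0 else b + 1`. -/
def unpairStep₂ {Γ : Ctx} : Term Γ (.nat ↣ .nat ↣ .nat ↣ .nat) :=
  .lam (.lam (.lam (cond (.var (.there (.there .here)))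
    .zero (.app .succ (.var (.there .here))))))

/-- First component of the pair coded by `p`. The pairs are enumerated diagonal by diagonal:
`(0,0), (1,0), (0,1), (2,0), (1,1), (0,2), …`. -/
def unpairFst {Γ : Ctx} (p : Term Γ .nat) : Term Γ .nat :=
  .app (.app (.app (.app (.app (.recursor [.nat, .nat] .here) p) .zero) .zero)
    unpairStep₁) unpairStep₂

/-- Second component of the pair coded by `p`. -/
def unpairSnd {Γ : Ctx} (p : Term Γ .nat) : Term Γ .nat :=
  .app (.app (.app (.app (.app (.recursor [.nat, .nat] (.there .here)) p) .zero) .zero)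
    unpairStep₁) unpairStep₂

/-- The head of a nonempty sequence. -/
def seqHead {Γ : Ctx} (s : Term Γ .nat) : Term Γ .nat := unpairFst (pred s)

/-- The tail of a sequence (the tail of the empty sequence is empty). -/
def seqTail {Γ : Ctx} (s : Term Γ .nat) : Term Γ .nat := unpairSnd (pred s)

/-- The sequence `s` without its first `i` components. -/
def seqDrop {Γ : Ctx} (i s : Term Γ .nat) : Term Γ .nat :=
  natRec i s (.lam (.lam (seqTail (.var (.there .here)))))

/-- `y ∈ s`: the number `y` is one of the components of the sequence coded by `s`, i.e. for some
`i` (less than the length of `s`), dropping `i` components leaves a nonempty sequence with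
head `y`. -/
def mem {Γ : Ctx} (y s : Term Γ .nat) : Fml Γ :=
  .ex .nat ((Fml.neg (.eq (seqDrop (.var .here) (s.wk .nat)) .zero)).and
    (.eq (y.wk .nat) (seqHead (seqDrop (.var .here) (s.wk .nat)))))

/-! ### Herbrandized choice for numbers -/

/-- `φ(x, y)`, with `x` at index `1` and `y` at index `0`, regarded as a formula in the context of
`y`, `x` and a further (outermost) variable of type `0 → 0`. -/
def Fml.addOuter (φ : Fml [.nat, .nat]) : Fml [.nat, .nat, .nat ↣ .nat] :=
  φ.subst (Sub.cons (.var .here) (Sub.cons (.var (.there .here)) (Sub.nil _)))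

/-- The sentence `∀ x⁰ ∃ y⁰ φ(x, y) → ∃ f^{0 → 0} ∀ x⁰ ∃ y⁰ (y ∈ f(x) ∧ φ(x, y))`. -/
def herbrandChoice (φ : Fml [.nat, .nat]) : Fml [] :=
  (Fml.all .nat (.ex .nat φ)).imp
    (.ex (.nat ↣ .nat) (.all .nat (.ex .nat
      ((mem (.var .here) (.app (.var (.there (.there .here))) (.var (.there .here)))).and
        φ.addOuter))))

end EPAomega

/-!
The sentence fails in the model of the hereditarily effective operations (HEO). There the objects of
type `0` are the natural numbers and the objects of type `σ → τ` are the numbers that code, by Kleene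
application `ap`, an operation from the objects of type `σ` to those of type `τ` which respects
extensional equality `rel`. Equality at higher types is defined extensionally in the language, so
that `rel` is exactly its interpretation (`sat_eqAt`), and codes need not be identified. The
combinators and the simultaneous recursors have realizers which satisfy their defining equations
literally (`D.exists_combK`, `D.exists_combS`, `D.exists_recursor`), because iterated currying turns
every partial recursive function of a list of arguments into a code (`apMany_abs_iterate`).
As the numbers are the standard ones, induction holds for all formulas, and everything derivable
is true in the model (`Derives.sat`).

Primitive recursive functions are given by terms (`exists_term_of_primrec`), so there is a formula
`φ(x, y)` saying that the program `x`, if it halts at all on input `0`, does so within `y` steps.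
Classically `∀ x ∃ y φ(x, y)` is true. Every component of a coded sequence is bounded by its code
(`le_of_sat_mem`) and `φ(x, y)` is monotone in `y`; hence a function `f` with
`∀ x ∃ y (y ∈ f(x) ∧ φ(x, y))` itself bounds the halting times. But the functions of type `0 → 0`
of the model are computable, and such an `f` would decide the halting problem.
-/

namespace EPAomega

/-! ### Kleene application and currying -/

/-- Kleene application `{e}(n)` of the partial recursive function with code `e`. -/
def ap (e n : ℕ) : Part ℕ := (Denumerable.ofNat Nat.Partrec.Code e).eval n

theorem ap_partrec : Partrec₂ ap :=
  Nat.Partrec.Code.eval_part.comp ((Computable.ofNat _).comp Computable.fst) Computable.snd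

/-- The s-m-n theorem: the code of a section of a partial recursive function is computable. -/
theorem exists_computable_ap_eq {α : Type*} [Primcodable α] {f : α → ℕ →. ℕ} (hf : Partrec₂ f) :
    ∃ g : α → ℕ, Computable g ∧ ∀ a n, ap (g a) n = f a n := by
  obtain ⟨c, hc⟩ := Nat.Partrec.Code.exists_code.1 hf
  refine ⟨fun a => Encodable.encode (c.curry (Encodable.encode a)), ?_, fun a n => ?_⟩
  · exact Computable.encode.comp
      (Nat.Partrec.Code.primrec₂_curry.to_comp.comp (Computable.const c) Computable.encode)
  · rw [ap, Denumerable.ofNat_encode, Nat.Partrec.Code.eval_curry, hc]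
    have : Nat.pair (Encodable.encode a) n = Encodable.encode (a, n) := by simp
    rw [this]
    simp [Part.map_id']

/-- A computable function that sends a list `l` to a code of `a ↦ F (l ++ [a])`
(for partial recursive `F`; the value is irrelevant otherwise). -/
noncomputable def absCode (F : List ℕ →. ℕ) : List ℕ → ℕ :=
  open Classical in
  if h : ∃ g : List ℕ → ℕ, Computable g ∧ ∀ l a, ap (g l) a = F (l ++ [a]) then h.choose
  else fun _ => 0

/-- Abstraction of the last entry of the argument list: `l ↦ Λ a. F (l ++ [a])`. -/
noncomputable def abs (F : List ℕ →. ℕ) : List ℕ →. ℕ := fun l => Part.some (absCode F l)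

theorem absCode_spec {F : List ℕ →. ℕ} (hF : Partrec F) :
    Computable (absCode F) ∧ ∀ l a, ap (absCode F l) a = F (l ++ [a]) := by
  have h : ∃ g : List ℕ → ℕ, Computable g ∧ ∀ l a, ap (g l) a = F (l ++ [a]) :=
    exists_computable_ap_eq (f := fun l a => F (l ++ [a]))
      (hF.comp (Computable.list_concat.comp Computable.fst Computable.snd))
  rw [absCode, dif_pos h]
  exact h.choose_spec

theorem abs_partrec {F : List ℕ →. ℕ} (hF : Partrec F) : Partrec (abs F) :=
  (absCode_spec hF).1.partrec

theorem abs_iterate_partrec {F : List ℕ →. ℕ} (hF : Partrec F) (k : ℕ) : Partrec (abs^[k] F) := by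
  induction k with
  | zero => exact hF
  | succ k ih => rw [Function.iterate_succ_apply']; exact abs_partrec ih

/-- Iterated Kleene application to the entries of a list. -/
def apMany : Part ℕ → List ℕ → Part ℕ
  | p, [] => p
  | p, a :: as => apMany (p.bind fun e => ap e a) as

theorem apMany_append (p : Part ℕ) (as bs : List ℕ) :
    apMany p (as ++ bs) = apMany (apMany p as) bs := by
  induction as generalizing p with
  | nil => rfl
  | cons a as ih => exact ih _

/-- Uncurrying: applying the code obtained by `as.length` abstractions to the entries of `as` one
after the other gives back the value of `F`. -/
theorem apMany_abs_iterate {F : List ℕ →. ℕ} (hF : Partrec F) (l as : List ℕ) :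
    apMany ((abs^[as.length] F) l) as = F (l ++ as) := by
  induction as generalizing l with
  | nil => simp [apMany]
  | cons a as ih =>
    have : ((abs^[(a :: as).length] F) l).bind (fun e => ap e a)
        = (abs^[as.length] F) (l ++ [a]) := by
      rw [List.length_cons, Function.iterate_succ_apply', abs, Part.bind_some,
        (absCode_spec (abs_iterate_partrec hF _)).2]
    rw [apMany, this, ih]
    simp

/-! ### The hereditarily effective operations -/

/-- The partial equivalence relations of the hereditarily effective operations: `rel σ a b` says
that `a` and `b` are codes of the same operation of type `σ`. -/
def rel : FType → ℕ → ℕ → Prop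
  | .nat, a, b => a = b
  | .arrow σ τ, e, e' => ∀ a b, rel σ a b → ∃ v ∈ ap e a, ∃ w ∈ ap e' b, rel τ v w

theorem rel_symm {σ : FType} {a b : ℕ} (h : rel σ a b) : rel σ b a := by
  induction σ generalizing a b with
  | nat => exact Eq.symm h
  | arrow σ τ ihσ ihτ =>
    intro x y hxy
    obtain ⟨v, hv, w, hw, hvw⟩ := h y x (ihσ hxy)
    exact ⟨w, hw, v, hv, ihτ hvw⟩

theorem rel_trans {σ : FType} {a b c : ℕ} (h : rel σ a b) (h' : rel σ b c) : rel σ a c := by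
  induction σ generalizing a b c with
  | nat => exact Eq.trans h h'
  | arrow σ τ ihσ ihτ =>
    intro x y hxy
    obtain ⟨v, hv, w, hw, hvw⟩ := h x y hxy
    obtain ⟨w', hw', u, hu, hwu⟩ := h' y y (ihσ (rel_symm hxy) hxy)
    cases Part.mem_unique hw hw'
    exact ⟨v, hv, u, hu, ihτ hvw hwu⟩

/-- The domain of type `σ`: the codes of hereditarily effective operations of type `σ`. Codes are
not identified; extensional equality is `rel`. -/
abbrev D (σ : FType) : Type := {n : ℕ // rel σ n n}

theorem D.ap_spec {σ τ : FType} (f : D (σ ↣ τ)) (a : D σ) :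
    ∃ v, v ∈ ap f.1 a.1 ∧ rel τ v v := by
  obtain ⟨v, hv, w, hw, h⟩ := f.2 a.1 a.1 a.2
  exact ⟨v, hv, rel_trans h (rel_symm h)⟩

/-- Application of hereditarily effective operations. -/
noncomputable def D.app {σ τ : FType} (f : D (σ ↣ τ)) (a : D σ) : D τ :=
  ⟨(D.ap_spec f a).choose, (D.ap_spec f a).choose_spec.2⟩

theorem D.ap_eq {σ τ : FType} (f : D (σ ↣ τ)) (a : D σ) :
    ap f.1 a.1 = Part.some (f.app a).1 :=
  Part.eq_some_iff.2 (D.ap_spec f a).choose_spec.1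

theorem D.eq_of_some_eq {σ : FType} {a b : D σ} (h : Part.some a.1 = Part.some b.1) : a = b :=
  Subtype.ext (Part.some_inj.1 h)

theorem rel_app {σ τ : FType} {f f' : D (σ ↣ τ)} {a a' : D σ} (hf : rel (σ ↣ τ) f.1 f'.1)
    (ha : rel σ a.1 a'.1) : rel τ (f.app a).1 (f'.app a').1 := by
  obtain ⟨v, hv, w, hw, h⟩ := hf _ _ ha
  rw [D.ap_eq] at hv hw
  rwa [Part.mem_some_iff.1 hv, Part.mem_some_iff.1 hw] at h

theorem rel_arrow_iff {σ τ : FType} {f g : D (σ ↣ τ)} :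
    rel (σ ↣ τ) f.1 g.1 ↔ ∀ a : D σ, rel τ (f.app a).1 (g.app a).1 := by
  refine ⟨fun h a => rel_app h a.2, fun h a b hab => ?_⟩
  let a' : D σ := ⟨a, rel_trans hab (rel_symm hab)⟩
  let b' : D σ := ⟨b, rel_trans (rel_symm hab) hab⟩
  refine ⟨_, (D.ap_eq f a').symm ▸ Part.mem_some _, _, (D.ap_eq g b').symm ▸ Part.mem_some _, ?_⟩
  exact rel_trans (rel_app (f := f) (a := a') (a' := b') f.2 hab) (h b')

/-- Iterated application to a tuple indexed by the positions in `ρs`. -/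
noncomputable def D.appMany {F : FType → FType} {τ : FType} : (ρs : List FType) →
    D (arrows F ρs τ) → (∀ σ : FType, Var ρs σ → D (F σ)) → D τ
  | [], f, _ => f
  | _ :: ρs, f, u => D.appMany ρs (D.app f (u _ .here)) (fun σ v => u σ (.there v))

theorem rel_appMany {F : FType → FType} {τ : FType} (ρs : List FType) {f f' : D (arrows F ρs τ)}
    {u u' : ∀ σ : FType, Var ρs σ → D (F σ)} (hf : rel (arrows F ρs τ) f.1 f'.1)
    (hu : ∀ σ v, rel (F σ) (u σ v).1 (u' σ v).1) :
    rel τ (D.appMany ρs f u).1 (D.appMany ρs f' u').1 := by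
  induction ρs with
  | nil => exact hf
  | cons ρ ρs ih => exact ih (rel_app (σ := F ρ) hf (hu _ _)) fun σ v => hu σ _

/-- The list of the codes of a tuple indexed by the positions in `ρs`. -/
def D.toList {F : FType → FType} : (ρs : List FType) → (∀ σ : FType, Var ρs σ → D (F σ)) → List ℕ
  | [], _ => []
  | _ :: ρs, u => (u _ .here).1 :: D.toList ρs (fun σ v => u σ (.there v))

@[simp]
theorem D.length_toList {F : FType → FType} (ρs : List FType)
    (u : ∀ σ : FType, Var ρs σ → D (F σ)) : (D.toList ρs u).length = ρs.length := by
  induction ρs with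
  | nil => rfl
  | cons ρ ρs ih => simp [D.toList, ih]

theorem D.apMany_toList {F : FType → FType} {τ : FType} (ρs : List FType) (f : D (arrows F ρs τ))
    (u : ∀ σ : FType, Var ρs σ → D (F σ)) :
    apMany (Part.some f.1) (D.toList ρs u) = Part.some (D.appMany ρs f u).1 := by
  induction ρs with
  | nil => rfl
  | cons ρ ρs ih =>
    rw [D.toList, apMany, Part.bind_some]
    exact (D.ap_eq (σ := F ρ) f (u _ .here)).symm ▸ ih _ _

/-- Both partial values are defined, and they are codes of the same operation of type `τ`. -/
def Good (τ : FType) (p q : Part ℕ) : Prop := ∃ v ∈ p, ∃ w ∈ q, rel τ v w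

theorem good_abs {σ τ : FType} {F : List ℕ →. ℕ} (hF : Partrec F) {l l' : List ℕ}
    (h : ∀ a b : D σ, rel σ a.1 b.1 → Good τ (F (l ++ [a.1])) (F (l' ++ [b.1]))) :
    Good (σ ↣ τ) (abs F l) (abs F l') := by
  refine ⟨_, Part.mem_some _, _, Part.mem_some _, fun a b hab => ?_⟩
  rw [(absCode_spec hF).2, (absCode_spec hF).2]
  exact h ⟨a, rel_trans hab (rel_symm hab)⟩ ⟨b, rel_trans (rel_symm hab) hab⟩ hab

/-- Curried functions respect extensional equality if the function of the argument list does. -/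
theorem good_abs_iterate {T : FType → FType} {τ : FType} {F : List ℕ →. ℕ} (hF : Partrec F)
    (ρs : List FType) {l l' : List ℕ}
    (h : ∀ u u' : ∀ σ : FType, Var ρs σ → D (T σ), (∀ σ v, rel (T σ) (u σ v).1 (u' σ v).1) →
      Good τ (F (l ++ D.toList ρs u)) (F (l' ++ D.toList ρs u'))) :
    Good (arrows T ρs τ) ((abs^[ρs.length] F) l) ((abs^[ρs.length] F) l') := by
  induction ρs generalizing l l' with
  | nil =>
    simpa [D.toList, arrows] using
      h (fun _ v => nomatch v) (fun _ v => nomatch v) (fun _ v => nomatch v)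
  | cons ρ ρs ih =>
    rw [List.length_cons, Function.iterate_succ_apply']
    refine good_abs (abs_iterate_partrec hF _) fun a b hab => ih fun u u' hu => ?_
    let w (a : D (T ρ)) (u : ∀ σ : FType, Var ρs σ → D (T σ)) (σ : FType) :
        Var (ρ :: ρs) σ → D (T σ)
      | .here => a
      | .there v => u σ v
    have := h (w a u) (w b u') (by rintro σ (_ | v); exacts [hab, hu _ _])
    simpa [D.toList, w] using this

/-! ### Realizers of the combinators -/

theorem ap_bind_partrec {α : Type*} [Primcodable α] {f g : α →. ℕ} (hf : Partrec f)
    (hg : Partrec g) : Partrec fun a => (f a).bind fun e => (g a).bind fun n => ap e n :=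
  hf.bind ((hg.comp Computable.fst).bind
    (ap_partrec.comp (Computable.snd.comp Computable.fst) Computable.snd))

theorem getD_computable (i : ℕ) : Computable fun l : List ℕ => l.getD i 0 :=
  ((Primrec.list_getD 0).comp Primrec.id (Primrec.const i)).to_comp

theorem D.exists_combK (σ τ : FType) :
    ∃ k : D (σ ↣ τ ↣ σ), ∀ x y, (k.app x).app y = x := by
  let F : List ℕ →. ℕ := fun l => Part.some (l.getD 0 0)
  have hF : Partrec F := (getD_computable 0).partrec
  have h : Good (σ ↣ τ ↣ σ) ((abs^[2] F) []) ((abs^[2] F) []) :=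
    good_abs (abs_partrec hF) fun a b hab => good_abs hF fun c d _ =>
      ⟨_, Part.mem_some _, _, Part.mem_some _, by simpa using hab⟩
  obtain ⟨k, hk, k', hk', hkk⟩ := h
  refine ⟨⟨k, rel_trans hkk (rel_symm hkk)⟩, fun x y => D.eq_of_some_eq ?_⟩
  have := apMany_abs_iterate hF [] [x.1, y.1]
  simp only [List.length_cons, List.length_nil, Nat.zero_add, Nat.reduceAdd,
    Part.eq_some_iff.2 hk, apMany, Part.bind_some] at this
  rw [D.ap_eq (σ := σ) (τ := τ ↣ σ) ⟨k, _⟩ x, Part.bind_some, D.ap_eq] at this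
  · simpa [F] using this

theorem D.exists_combS (ρ σ τ : FType) :
    ∃ s : D ((ρ ↣ σ ↣ τ) ↣ (ρ ↣ σ) ↣ ρ ↣ τ), ∀ x y z,
      ((s.app x).app y).app z = (x.app z).app (y.app z) := by
  let F : List ℕ →. ℕ := fun l => (ap (l.getD 0 0) (l.getD 2 0)).bind fun e =>
    (ap (l.getD 1 0) (l.getD 2 0)).bind fun n => ap e n
  have hF : Partrec F := ap_bind_partrec
    (ap_partrec.comp (getD_computable 0) (getD_computable 2))
    (ap_partrec.comp (getD_computable 1) (getD_computable 2))
  have key (x : D (ρ ↣ σ ↣ τ)) (y : D (ρ ↣ σ)) (z : D ρ) :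
      F [x.1, y.1, z.1] = Part.some ((x.app z).app (y.app z)).1 := by
    simp [F, D.ap_eq]
  have h : Good ((ρ ↣ σ ↣ τ) ↣ (ρ ↣ σ) ↣ ρ ↣ τ) ((abs^[3] F) []) ((abs^[3] F) []) :=
    good_abs (abs_iterate_partrec hF 2) fun x x' hx => good_abs (abs_partrec hF) fun y y' hy =>
      good_abs hF fun z z' hz => ⟨_, Part.eq_some_iff.1 (key x y z), _,
        Part.eq_some_iff.1 (key x' y' z'), rel_app (rel_app hx hz) (rel_app hy hz)⟩
  obtain ⟨k, hk, k', hk', hkk⟩ := h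
  refine ⟨⟨k, rel_trans hkk (rel_symm hkk)⟩, fun x y z => D.eq_of_some_eq ?_⟩
  have := apMany_abs_iterate hF [] [x.1, y.1, z.1]
  simp only [List.length_cons, List.length_nil, Nat.zero_add, Nat.reduceAdd,
    Part.eq_some_iff.2 hk, apMany, Part.bind_some, List.nil_append, key] at this
  rw [D.ap_eq (σ := ρ ↣ σ ↣ τ) ⟨k, _⟩ x, Part.bind_some, D.ap_eq, Part.bind_some, D.ap_eq] at this
  exact this

theorem D.exists_succ : ∃ s : D (.nat ↣ .nat), ∀ n, (s.app n).1 = n.1 + 1 := by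
  obtain ⟨g, -, hg⟩ := exists_computable_ap_eq (α := Unit) (f := fun _ n => Part.some (n + 1))
    (Computable.succ.comp Computable.snd).partrec
  have h : rel (.nat ↣ .nat) (g ()) (g ()) := by
    rintro a _ rfl
    exact ⟨a + 1, by simp [hg], a + 1, by simp [hg], rfl⟩
  refine ⟨⟨g (), h⟩, fun n => ?_⟩
  have := D.ap_eq (σ := .nat) (τ := .nat) ⟨g (), h⟩ n
  rw [hg] at this
  exact (Part.some_inj.1 this).symm

/-! ### Realizers of the simultaneous recursors -/

/-- The index of a position. -/
def Var.idx : {Γ : Ctx} → {σ : FType} → Var Γ σ → ℕ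
  | _, _, .here => 0
  | _, _, .there v => v.idx + 1

theorem Var.exists_idx_eq {Γ : Ctx} {j : ℕ} (hj : j < Γ.length) :
    ∃ (σ : FType) (v : Var Γ σ), v.idx = j := by
  induction Γ generalizing j with
  | nil => simp at hj
  | cons τ Γ ih =>
    cases j with
    | zero => exact ⟨τ, .here, rfl⟩
    | succ j =>
      obtain ⟨σ, v, rfl⟩ := ih (by simpa using hj)
      exact ⟨σ, .there v, rfl⟩

theorem D.toList_getD_idx {F : FType → FType} {ρs : List FType} {σ : FType}
    (u : ∀ σ : FType, Var ρs σ → D (F σ)) (v : Var ρs σ) :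
    (D.toList ρs u).getD v.idx 0 = (u σ v).1 := by
  induction v with
  | here => rfl
  | there v ih => simpa [D.toList, Var.idx] using ih _

/-- Application of `z` to the first `k` entries of a list. -/
def apFirst : ℕ → ℕ → List ℕ → Part ℕ
  | 0, z, _ => Part.some z
  | k + 1, z, l => (apFirst k z l).bind fun e => ap e (l.getD k 0)

theorem apFirst_partrec {α : Type*} [Primcodable α] {f : α → ℕ} {g : α → List ℕ}
    (hf : Computable f) (hg : Computable g) (k : ℕ) : Partrec fun a => apFirst k (f a) (g a) := by
  induction k with
  | zero => exact hf.partrec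
  | succ k ih =>
    exact ih.bind (ap_partrec.comp Computable.snd
      ((getD_computable k).comp (hg.comp Computable.fst)))

theorem apFirst_eq (z : ℕ) {k : ℕ} {l : List ℕ} (hk : k ≤ l.length) :
    apFirst k z l = apMany (Part.some z) (l.take k) := by
  induction k with
  | zero => rfl
  | succ k ih =>
    have hk' : k < l.length := hk
    rw [List.take_succ_eq_append_getElem hk', apMany_append, apFirst, ih hk'.le,
      List.getD_eq_getElem _ _ hk']
    rfl

/-- The list of the values of `g 0, …, g (k - 1)`. -/
def collect {α : Type*} (g : ℕ → α → Part ℕ) : ℕ → α → Part (List ℕ)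
  | 0, _ => Part.some []
  | k + 1, a => (collect g k a).bind fun l => (g k a).map fun n => l ++ [n]

theorem collect_partrec {α : Type*} [Primcodable α] {g : ℕ → α → Part ℕ} (hg : ∀ j, Partrec (g j))
    (k : ℕ) : Partrec (collect g k) := by
  induction k with
  | zero => exact (Computable.const []).partrec
  | succ k ih =>
    exact ih.bind (((hg k).comp Computable.fst).map
      (Computable.list_concat.comp (Computable.snd.comp Computable.fst) Computable.snd))

theorem collect_eq {α : Type*} {g : ℕ → α → Part ℕ} {a : α} {l : List ℕ} {k : ℕ} (hk : k ≤ l.length)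
    (h : ∀ j < k, g j a = Part.some (l.getD j 0)) : collect g k a = Part.some (l.take k) := by
  induction k with
  | zero => rfl
  | succ k ih =>
    have hk' : k < l.length := hk
    rw [collect, ih hk'.le fun j hj => h j (by omega), h k (by omega), Part.bind_some,
      Part.map_some, List.take_succ_eq_append_getElem hk', List.getD_eq_getElem _ _ hk']

/-- One step of a simultaneous recursion of `k` components. The list `l` holds the recursion
argument, the `k` initial values and the `k` step functions; `p` holds the current stage and the
list of current values. -/
def recStep (k : ℕ) (l : List ℕ) (p : ℕ × List ℕ) : Part (List ℕ) :=
  collect (fun j (q : List ℕ × ℕ × List ℕ) =>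
    (apFirst k (q.1.getD (k + 1 + j) 0) q.2.2).bind fun e => ap e q.2.1) k (l, p)

theorem recStep_partrec (k : ℕ) : Partrec₂ (recStep k) :=
  collect_partrec (fun j => by
    refine Partrec.bind (apFirst_partrec ((getD_computable _).comp Computable.fst)
      (Computable.snd.comp Computable.snd) k) ?_
    exact ap_partrec.comp Computable.snd
      (Computable.fst.comp (Computable.snd.comp Computable.fst))) k

/-- The list of the values after `n` steps of a simultaneous recursion of `k` components. -/
def recState (k : ℕ) (l : List ℕ) (n : ℕ) : Part (List ℕ) :=
  Nat.rec (Part.some ((l.drop 1).take k)) (fun m s => s.bind fun st => recStep k l (m, st)) n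

/-- Component `i` of a simultaneous recursion of `k` components, as a function of the list of its
arguments. -/
def recFun (k i : ℕ) (l : List ℕ) : Part ℕ :=
  (recState k l (l.getD 0 0)).map fun st => st.getD i 0

theorem recFun_partrec (k i : ℕ) : Partrec (recFun k i) := by
  refine Partrec.map ?_ ((getD_computable i).comp Computable.snd)
  refine Partrec.nat_rec (h := fun l p => recStep k l p) (getD_computable 0) ?_ (recStep_partrec k)
  exact ((Primrec.list_take.comp (Primrec.const k)
    (Primrec.list_drop.comp (Primrec.const 1) Primrec.id)).to_comp).partrec

/-- Every number is a hereditarily effective operation of type `0`. -/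
def D.ofNat (n : ℕ) : D .nat := ⟨n, rfl⟩

@[simp]
theorem D.ofNat_val (n : ℕ) : (D.ofNat n).1 = n := rfl

/-- Simultaneous recursion on hereditarily effective operations. -/
noncomputable def D.simRec {ρs : List FType} (y : ∀ σ : FType, Var ρs σ → D σ)
    (z : ∀ σ : FType, Var ρs σ → D (stepType ρs σ)) : ℕ → ∀ σ : FType, Var ρs σ → D σ
  | 0 => y
  | n + 1 => fun σ i =>
    D.app (D.appMany (F := fun ρ => ρ) ρs (z σ i) (D.simRec y z n)) (D.ofNat n)

theorem rel_simRec {ρs : List FType} {y y' : ∀ σ : FType, Var ρs σ → D σ}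
    {z z' : ∀ σ : FType, Var ρs σ → D (stepType ρs σ)}
    (hy : ∀ σ v, rel σ (y σ v).1 (y' σ v).1)
    (hz : ∀ σ v, rel (stepType ρs σ) (z σ v).1 (z' σ v).1) (n : ℕ) (σ : FType) (v : Var ρs σ) :
    rel σ (D.simRec y z n σ v).1 (D.simRec y' z' n σ v).1 := by
  induction n generalizing σ with
  | zero => exact hy σ v
  | succ n ih =>
    exact rel_app (rel_appMany (F := fun ρ => ρ) ρs (hz σ v) fun σ v => ih σ v) rfl

theorem recState_eq {ρs : List FType} (x : ℕ) (y : ∀ σ : FType, Var ρs σ → D σ)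
    (z : ∀ σ : FType, Var ρs σ → D (stepType ρs σ)) (n : ℕ) :
    recState ρs.length (x :: (D.toList (F := fun ρ => ρ) ρs y ++ D.toList (F := stepType ρs) ρs z))
      n = Part.some (D.toList (F := fun ρ => ρ) ρs (D.simRec y z n)) := by
  induction n with
  | zero => simp [recState, D.simRec]
  | succ n ih =>
    have hlen := D.length_toList (F := fun ρ => ρ) ρs (D.simRec y z (n + 1))
    have hstep (l : List ℕ) : recState ρs.length l (n + 1) =
        (recState ρs.length l n).bind fun st => recStep ρs.length l (n, st) := rfl
    rw [hstep, ih, Part.bind_some, recStep,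
      collect_eq (l := D.toList (F := fun ρ => ρ) ρs (D.simRec y z (n + 1))) hlen.ge, ← hlen,
      List.take_length]
    intro j hj
    obtain ⟨σ, v, rfl⟩ := Var.exists_idx_eq hj
    have hidx : (x :: (D.toList (F := fun ρ => ρ) ρs y ++ D.toList (F := stepType ρs) ρs z)).getD
        (ρs.length + 1 + v.idx) 0 = (z σ v).1 := by
      rw [← D.toList_getD_idx (F := stepType ρs) z v, Nat.add_right_comm, List.getD_cons_succ,
        List.getD_append_right _ _ _ _ (by simp)]
      simp
    rw [hidx, apFirst_eq _ (by simp), List.take_of_length_le (by simp),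
      D.apMany_toList (F := fun ρ => ρ), Part.bind_some,
      D.toList_getD_idx (F := fun ρ => ρ) (D.simRec y z (n + 1)) v]
    exact D.ap_eq _ (D.ofNat n)

theorem recFun_eq {ρs : List FType} {τ : FType} (i : Var ρs τ) (x : ℕ)
    (y : ∀ σ : FType, Var ρs σ → D σ) (z : ∀ σ : FType, Var ρs σ → D (stepType ρs σ)) :
    recFun ρs.length i.idx
      (x :: (D.toList (F := fun ρ => ρ) ρs y ++ D.toList (F := stepType ρs) ρs z)) =
      Part.some (D.simRec y z x τ i).1 := by
  rw [recFun, List.getD_cons_zero, recState_eq, Part.map_some,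
    D.toList_getD_idx (F := fun ρ => ρ)]

theorem D.exists_recursor (ρs : List FType) {τ : FType} (i : Var ρs τ) :
    ∃ r : D (recType ρs τ), ∀ x y z,
      D.appMany (F := stepType ρs) ρs (D.appMany (F := fun ρ => ρ) ρs (r.app x) y) z =
        D.simRec y z x.1 τ i := by
  let k := ρs.length
  let F := recFun k i.idx
  have hF : Partrec F := recFun_partrec k i.idx
  have h : Good (recType ρs τ) (abs (abs^[k] (abs^[k] F)) []) (abs (abs^[k] (abs^[k] F)) []) :=
    good_abs (abs_iterate_partrec (abs_iterate_partrec hF k) k) fun x x' hx =>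
      good_abs_iterate (T := fun ρ => ρ) (abs_iterate_partrec hF k) ρs fun y y' hy =>
        good_abs_iterate (T := stepType ρs) hF ρs fun z z' hz => by
          have hx' : x.1 = x'.1 := hx
          refine ⟨_, Part.eq_some_iff.1 (?_ : _ = Part.some (D.simRec y z x.1 τ i).1), _,
            Part.eq_some_iff.1 (?_ : _ = Part.some (D.simRec y' z' x.1 τ i).1),
            rel_simRec hy hz _ _ _⟩
          · simpa using recFun_eq i x.1 y z
          · simpa [hx'] using recFun_eq i x'.1 y' z'
  obtain ⟨r, hr, r', hr', hrr⟩ := h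
  refine ⟨⟨r, rel_trans hrr (rel_symm hrr)⟩, fun x y z => D.eq_of_some_eq ?_⟩
  -- `h3`, `h2` and `h1` compute the applications to `x`, to the tuple `y` and to the tuple `z`.
  have h1 := apMany_abs_iterate hF (x.1 :: D.toList (F := fun ρ => ρ) ρs y)
    (D.toList (F := stepType ρs) ρs z)
  have h2 := apMany_abs_iterate (abs_iterate_partrec hF k) [x.1] (D.toList (F := fun ρ => ρ) ρs y)
  have h3 := (absCode_spec (abs_iterate_partrec (abs_iterate_partrec hF k) k)).2 [] x.1
  rw [← Part.mem_some_iff.1 hr] at h3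
  have h4 := D.ap_eq (σ := .nat) ⟨r, rel_trans hrr (rel_symm hrr)⟩ x
  have h5 := D.apMany_toList (F := fun ρ => ρ) ρs
    (D.app (σ := .nat) ⟨r, rel_trans hrr (rel_symm hrr)⟩ x) y
  have h6 := D.apMany_toList (F := stepType ρs) ρs (D.appMany (F := fun ρ => ρ) ρs
    (D.app (σ := .nat) ⟨r, rel_trans hrr (rel_symm hrr)⟩ x) y) z
  rw [D.length_toList] at h1 h2
  rw [← h6, ← h5, ← h4]
  exact ((congrArg (fun p => apMany (apMany p _) _) h3).trans
    (congrArg (fun p => apMany p _) h2)).trans (h1.trans (recFun_eq i x.1 y z))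

/-! ### Interpretation of terms and formulas -/

/-- An assignment of hereditarily effective operations to the variables of `Γ`. -/
abbrev Env (Γ : Ctx) : Type := ∀ σ : FType, Var Γ σ → D σ

/-- Extend an assignment by a value for the most recent variable. -/
def Env.cons {Γ : Ctx} {τ : FType} (d : D τ) (e : Env Γ) : Env (τ :: Γ)
  | _, .here => d
  | _, .there v => e _ v

/-- The value of a term in the model of the hereditarily effective operations. -/
noncomputable def Term.eval {Γ : Ctx} (e : Env Γ) : {σ : FType} → Term Γ σ → D σ
  | _, .var v => e _ v
  | _, .zero => D.ofNat 0
  | _, .succ => D.exists_succ.choose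
  | _, .combK σ τ => (D.exists_combK σ τ).choose
  | _, .combS ρ σ τ => (D.exists_combS ρ σ τ).choose
  | _, .recursor ρs i => (D.exists_recursor ρs i).choose
  | _, .app t u => (t.eval e).app (u.eval e)

/-- Truth of a formula in the model of the hereditarily effective operations. -/
def Fml.Sat : {Γ : Ctx} → Env Γ → Fml Γ → Prop
  | _, e, .eq t u => (t.eval e).1 = (u.eval e).1
  | _, _, .bot => False
  | _, e, .and φ ψ => φ.Sat e ∧ ψ.Sat e
  | _, e, .or φ ψ => φ.Sat e ∨ ψ.Sat e
  | _, e, .imp φ ψ => φ.Sat e → ψ.Sat e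
  | _, e, .all σ φ => ∀ d : D σ, φ.Sat (Env.cons d e)
  | _, e, .ex σ φ => ∃ d : D σ, φ.Sat (Env.cons d e)

/-- The assignment to `Γ` given by the values of the terms of a substitution. -/
noncomputable def Sub.eval {Γ Δ : Ctx} (s : Sub Γ Δ) (e : Env Δ) : Env Γ :=
  fun σ v => (s σ v).eval e

theorem Term.eval_subst {Γ Δ : Ctx} {σ : FType} (s : Sub Γ Δ) (e : Env Δ) (t : Term Γ σ) :
    (t.subst s).eval e = t.eval (s.eval e) := by
  induction t with
  | app t u iht ihu => simp [Term.subst, Term.eval, iht, ihu]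
  | _ => rfl

theorem Sub.eval_cons {Γ Δ : Ctx} {τ : FType} (t : Term Δ τ) (s : Sub Γ Δ) (e : Env Δ) :
    (Sub.cons t s).eval e = Env.cons (t.eval e) (s.eval e) := by
  funext σ v
  cases v <;> rfl

theorem Sub.eval_shift {Γ : Ctx} {τ : FType} (d : D τ) (e : Env Γ) :
    (Sub.shift Γ τ).eval (Env.cons d e) = e := rfl

theorem Sub.eval_var {Γ : Ctx} (e : Env Γ) :
    Sub.eval (fun _ v => Term.var v : Sub Γ Γ) e = e := rfl

@[simp]
theorem Term.eval_wk {Γ : Ctx} {σ τ : FType} (t : Term Γ σ) (d : D τ) (e : Env Γ) :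
    (t.wk τ).eval (Env.cons d e) = t.eval e := by
  rw [Term.wk, Term.eval_subst, Sub.eval_shift]

theorem Sub.eval_lift {Γ Δ : Ctx} {τ : FType} (s : Sub Γ Δ) (d : D τ) (e : Env Δ) :
    (s.lift τ).eval (Env.cons d e) = Env.cons d (s.eval e) := by
  rw [Sub.lift, Sub.eval_cons]
  congr 1
  funext σ v
  exact Term.eval_wk _ _ _

theorem Fml.sat_subst {Γ Δ : Ctx} (s : Sub Γ Δ) (e : Env Δ) (φ : Fml Γ) :
    (φ.subst s).Sat e ↔ φ.Sat (s.eval e) := by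
  induction φ generalizing Δ with
  | eq t u => simp [Fml.subst, Fml.Sat, Term.eval_subst]
  | bot => rfl
  | and φ ψ ihφ ihψ => simp [Fml.subst, Fml.Sat, ihφ, ihψ]
  | or φ ψ ihφ ihψ => simp [Fml.subst, Fml.Sat, ihφ, ihψ]
  | imp φ ψ ihφ ihψ => simp [Fml.subst, Fml.Sat, ihφ, ihψ]
  | all σ φ ih => simp [Fml.subst, Fml.Sat, ih, Sub.eval_lift]
  | ex σ φ ih => simp [Fml.subst, Fml.Sat, ih, Sub.eval_lift]

@[simp]
theorem Fml.sat_wk {Γ : Ctx} {τ : FType} (φ : Fml Γ) (d : D τ) (e : Env Γ) :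
    (φ.wk τ).Sat (Env.cons d e) ↔ φ.Sat e := by
  rw [Fml.wk, Fml.sat_subst, Sub.eval_shift]

theorem Fml.sat_inst {Γ : Ctx} {τ : FType} (φ : Fml (τ :: Γ)) (t : Term Γ τ) (e : Env Γ) :
    (φ.inst t).Sat e ↔ φ.Sat (Env.cons (t.eval e) e) := by
  rw [Fml.inst, Fml.sat_subst, Sub.eval_cons, Sub.eval_var]

/-! ### Values of particular terms -/

@[simp]
theorem Term.eval_app {Γ : Ctx} {σ τ : FType} (e : Env Γ) (t : Term Γ (σ ↣ τ)) (u : Term Γ σ) :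
    (Term.app t u).eval e = (t.eval e).app (u.eval e) := rfl

@[simp]
theorem Term.eval_var_here {Γ : Ctx} {σ : FType} (d : D σ) (e : Env Γ) :
    (Term.var Var.here).eval (Env.cons d e) = d := rfl

@[simp]
theorem Term.eval_var_there {Γ : Ctx} {σ τ : FType} (v : Var Γ σ) (d : D τ) (e : Env Γ) :
    (Term.var (Var.there v)).eval (Env.cons d e) = (Term.var v).eval e := rfl

@[simp]
theorem Term.eval_zero {Γ : Ctx} (e : Env Γ) : (Term.zero.eval e).1 = 0 := rfl

@[simp]
theorem Term.eval_succ {Γ : Ctx} (e : Env Γ) (d : D .nat) :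
    ((Term.succ.eval e).app d).1 = d.1 + 1 := D.exists_succ.choose_spec d

@[simp]
theorem Term.eval_combK {Γ : Ctx} {σ τ : FType} (e : Env Γ) (x : D σ) (y : D τ) :
    (((Term.combK σ τ).eval e).app x).app y = x := (D.exists_combK σ τ).choose_spec x y

@[simp]
theorem Term.eval_combS {Γ : Ctx} {ρ σ τ : FType} (e : Env Γ) (x : D (ρ ↣ σ ↣ τ)) (y : D (ρ ↣ σ))
    (z : D ρ) : ((((Term.combS ρ σ τ).eval e).app x).app y).app z = (x.app z).app (y.app z) :=
  (D.exists_combS ρ σ τ).choose_spec x y z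

theorem Term.eval_recursor {Γ : Ctx} {ρs : List FType} {τ : FType} (i : Var ρs τ) (e : Env Γ)
    (x : D .nat) (y : ∀ σ : FType, Var ρs σ → D σ)
    (z : ∀ σ : FType, Var ρs σ → D (stepType ρs σ)) :
    D.appMany (F := stepType ρs) ρs
      (D.appMany (F := fun ρ => ρ) ρs (((Term.recursor ρs i).eval e).app x) y) z =
      D.simRec y z x.1 τ i := (D.exists_recursor ρs i).choose_spec x y z

@[simp]
theorem Term.eval_lam {Γ : Ctx} {σ τ : FType} (t : Term (σ :: Γ) τ) (e : Env Γ) (d : D σ) :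
    (t.lam.eval e).app d = t.eval (Env.cons d e) := by
  induction t with
  | var v => cases v <;> simp [Term.lam]
  | app t u iht ihu => simp [Term.lam, iht, ihu]
  | _ => simp [Term.lam]; rfl

theorem eval_appMany {Γ : Ctx} {F : FType → FType} {τ : FType} (ρs : List FType) (e : Env Γ)
    (t : Term Γ (arrows F ρs τ)) (u : ∀ σ : FType, Var ρs σ → Term Γ (F σ)) :
    (appMany ρs t u).eval e = D.appMany ρs (t.eval e) fun σ v => (u σ v).eval e := by
  induction ρs with
  | nil => rfl
  | cons ρ ρs ih => exact ih _ _

theorem eval_recApp {Γ : Ctx} {ρs : List FType} {τ : FType} (i : Var ρs τ) (e : Env Γ)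
    (x : Term Γ .nat) (y : ∀ σ : FType, Var ρs σ → Term Γ σ)
    (z : ∀ σ : FType, Var ρs σ → Term Γ (stepType ρs σ)) :
    (recApp i x y z).eval e =
      D.simRec (fun σ v => (y σ v).eval e) (fun σ v => (z σ v).eval e) (x.eval e).1 τ i := by
  rw [recApp, eval_appMany, eval_appMany (F := fun ρ => ρ)]
  exact Term.eval_recursor _ _ _ _ _

/-! ### Soundness -/

/-- Extensional equality, as defined in the language, is interpreted by `rel`. -/
theorem sat_eqAt {Γ : Ctx} (τ : FType) (s t : Term Γ τ) (e : Env Γ) :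
    (eqAt τ s t).Sat e ↔ rel τ (s.eval e).1 (t.eval e).1 := by
  induction τ generalizing Γ with
  | nat => rfl
  | arrow σ τ _ ih =>
    rw [rel_arrow_iff]
    simp [eqAt, Fml.Sat, ih]

theorem Ax.sat {Γ : Ctx} {φ : Fml Γ} (h : Ax φ) (e : Env Γ) : φ.Sat e := by
  cases h with
  | eq_refl t => rfl
  | eq_symm s t => exact Eq.symm
  | eq_trans s t u => exact fun h => h.1.trans h.2
  | ext z x y =>
    intro h
    rw [sat_eqAt] at h ⊢
    exact rel_app (z.eval e).2 h
  | succ_ne_zero t => intro h; simp [Fml.Sat] at h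
  | succ_inj s t => intro h; simpa [Fml.Sat] using h
  | induction φ =>
    rintro ⟨h0, hS⟩ d
    rw [Fml.sat_inst] at h0
    change φ.Sat (Env.cons (D.ofNat d.1) e)
    generalize d.1 = n
    induction n with
    | zero => exact h0
    | succ n ih =>
      have := hS (D.ofNat n) ih
      rw [Fml.instSucc, Fml.sat_subst, Sub.eval_cons, Sub.eval_shift] at this
      convert this using 2
      exact Subtype.ext (by simp)
  | combK x y => rw [sat_eqAt]; simpa using (x.eval e).2
  | combS x y z => rw [sat_eqAt]; simpa using (((x.eval e).app (z.eval e)).app _).2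
  | rec_zero i y z =>
    rw [sat_eqAt, eval_recApp]
    exact ((y _ i).eval e).2
  | @rec_succ ρs τ i x y z =>
    rw [sat_eqAt, eval_recApp, Term.eval_app, Term.eval_succ]
    have h : (appMany (F := fun ρ => ρ) ρs (z τ i) fun _ j => recApp j x y z).eval e =
        D.appMany (F := fun ρ => ρ) ρs ((z τ i).eval e)
          (D.simRec (fun σ v => (y σ v).eval e) (fun σ v => (z σ v).eval e) (x.eval e).1) :=
      (eval_appMany (F := fun ρ => ρ) ρs e (z τ i) _).trans (by simp only [eval_recApp])
    have h' := congrArg (fun d => (d.app (x.eval e)).1) h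
    exact (congrArg (rel τ _) h').mpr (D.simRec _ _ ((x.eval e).1 + 1) τ i).2

theorem Derives.sat {Γ : Ctx} {H : List (Fml Γ)} {φ : Fml Γ} (h : Derives H φ) (e : Env Γ)
    (hH : ∀ ψ ∈ H, ψ.Sat e) : φ.Sat e := by
  have hwk {Γ : Ctx} {H : List (Fml Γ)} {σ : FType} {e : Env Γ} (hH : ∀ ψ ∈ H, ψ.Sat e) (d : D σ) :
      ∀ ψ ∈ H.map (Fml.wk σ), ψ.Sat (Env.cons d e) := by
    simpa using hH
  induction h with
  | ax h => exact h.sat e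
  | hyp h => exact hH _ h
  | botE _ ih => exact (ih e hH).elim
  | em φ => exact Classical.em (φ.Sat e)
  | andI _ _ ih₁ ih₂ => exact ⟨ih₁ e hH, ih₂ e hH⟩
  | andE₁ _ ih => exact (ih e hH).1
  | andE₂ _ ih => exact (ih e hH).2
  | orI₁ _ ih => exact Or.inl (ih e hH)
  | orI₂ _ ih => exact Or.inr (ih e hH)
  | orE _ _ _ ih ih₁ ih₂ =>
    exact (ih e hH).elim (fun h => ih₁ e (List.forall_mem_cons.2 ⟨h, hH⟩))
      fun h => ih₂ e (List.forall_mem_cons.2 ⟨h, hH⟩)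
  | impI _ ih => exact fun h => ih e (List.forall_mem_cons.2 ⟨h, hH⟩)
  | impE _ _ ih₁ ih₂ => exact ih₁ e hH (ih₂ e hH)
  | allI _ ih => exact fun d => ih _ (hwk hH d)
  | allE t _ ih => exact (Fml.sat_inst _ _ _).2 (ih e hH _)
  | exI t _ ih => exact ⟨_, (Fml.sat_inst _ _ _).1 (ih e hH)⟩
  | exE _ _ ih₁ ih₂ =>
    obtain ⟨d, hd⟩ := ih₁ e hH
    exact (Fml.sat_wk _ d e).1 (ih₂ _ (List.forall_mem_cons.2 ⟨hd, hwk hH d⟩))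

/-! ### Components of coded sequences -/

theorem eval_natRec {Γ : Ctx} (e : Env Γ) (x y : Term Γ .nat) (z : Term Γ (.nat ↣ .nat ↣ .nat)) :
    (natRec x y z).eval e = Nat.rec (y.eval e)
      (fun n ih => ((z.eval e).app ih).app (D.ofNat n)) (x.eval e).1 := by
  have h := Term.eval_recursor (ρs := [.nat]) .here e (x.eval e)
    (fun | _, .here => y.eval e) (fun | _, .here => z.eval e)
  refine h.trans ?_
  generalize (x.eval e).1 = n
  induction n with
  | zero => rfl
  | succ n ih => exact congrArg (fun d => ((z.eval e).app d).app (D.ofNat n)) ih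

theorem eval_pred {Γ : Ctx} (e : Env Γ) (x : Term Γ .nat) :
    ((pred x).eval e).1 = (x.eval e).1 - 1 := by
  rw [pred, eval_natRec]
  cases (x.eval e).1 with
  | zero => rfl
  | succ n => simp

theorem eval_cond_of_eq_zero {Γ : Ctx} {e : Env Γ} {x : Term Γ .nat} (a b : Term Γ .nat)
    (h : (x.eval e).1 = 0) : (cond x a b).eval e = a.eval e := by
  simp [cond, eval_natRec, h]

theorem eval_cond_of_ne_zero {Γ : Ctx} {e : Env Γ} {x : Term Γ .nat} (a b : Term Γ .nat)
    (h : ¬(x.eval e).1 = 0) : (cond x a b).eval e = b.eval e := by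
  obtain ⟨n, hn⟩ := Nat.exists_eq_succ_of_ne_zero h
  rw [cond, eval_natRec, hn]
  simp

/-- The sum of the components does not exceed the code: each step of the diagonal enumeration of
the pairs increases the sum by at most `1`. -/
theorem eval_unpairFst_add_unpairSnd_le {Γ : Ctx} (e : Env Γ) (p : Term Γ .nat) :
    ((unpairFst p).eval e).1 + ((unpairSnd p).eval e).1 ≤ (p.eval e).1 := by
  let y : ∀ σ : FType, Var [.nat, .nat] σ → D σ := fun
    | _, .here => Term.zero.eval e
    | _, .there .here => Term.zero.eval e
  let z : ∀ σ : FType, Var [.nat, .nat] σ → D (stepType [.nat, .nat] σ) := fun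
    | _, .here => unpairStep₁.eval e
    | _, .there .here => unpairStep₂.eval e
  have h₁ : (unpairFst p).eval e = D.simRec y z (p.eval e).1 .nat .here :=
    Term.eval_recursor (ρs := [.nat, .nat]) .here e (p.eval e) y z
  have h₂ : (unpairSnd p).eval e = D.simRec y z (p.eval e).1 .nat (.there .here) :=
    Term.eval_recursor (ρs := [.nat, .nat]) (.there .here) e (p.eval e) y z
  rw [h₁, h₂]
  generalize (p.eval e).1 = n
  induction n with
  | zero => rfl
  | succ n ih =>
    have hS₁ : D.simRec y z (n + 1) .nat .here = (((unpairStep₁.eval e).app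
      (D.simRec y z n .nat .here)).app (D.simRec y z n .nat (.there .here))).app (D.ofNat n) := rfl
    have hS₂ : D.simRec y z (n + 1) .nat (.there .here) = (((unpairStep₂.eval e).app
      (D.simRec y z n .nat .here)).app (D.simRec y z n .nat (.there .here))).app (D.ofNat n) := rfl
    rw [hS₁, hS₂]
    generalize (D.simRec y z n .nat .here : D .nat) = a at ih ⊢
    generalize (D.simRec y z n .nat (.there .here) : D .nat) = b at ih ⊢
    simp only [unpairStep₁, unpairStep₂, Term.eval_lam]
    by_cases h : a.1 = 0
    · simp [eval_cond_of_eq_zero, h]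
      omega
    · simp [eval_cond_of_ne_zero, eval_pred, h]
      omega

theorem eval_seqHead_le {Γ : Ctx} (e : Env Γ) (s : Term Γ .nat) :
    ((seqHead s).eval e).1 ≤ (s.eval e).1 := by
  have h := eval_unpairFst_add_unpairSnd_le e (pred s)
  rw [eval_pred] at h
  rw [seqHead]
  omega

theorem eval_seqTail_le {Γ : Ctx} (e : Env Γ) (s : Term Γ .nat) :
    ((seqTail s).eval e).1 ≤ (s.eval e).1 := by
  have h := eval_unpairFst_add_unpairSnd_le e (pred s)
  rw [eval_pred] at h
  rw [seqTail]
  omega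

theorem eval_seqDrop_le {Γ : Ctx} (e : Env Γ) (i s : Term Γ .nat) :
    ((seqDrop i s).eval e).1 ≤ (s.eval e).1 := by
  rw [seqDrop, eval_natRec]
  induction (i.eval e).1 with
  | zero => exact le_rfl
  | succ n ih =>
    refine le_trans ?_ ih
    simp only [Term.eval_lam]
    exact eval_seqTail_le _ _

/-- A component of a sequence does not exceed the code of the sequence. -/
theorem le_of_sat_mem {Γ : Ctx} {e : Env Γ} {y s : Term Γ .nat} (h : (mem y s).Sat e) :
    (y.eval e).1 ≤ (s.eval e).1 := by
  obtain ⟨i, -, h⟩ := h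
  have h' : (y.eval e).1 = ((seqHead (seqDrop (.var .here) (s.wk .nat))).eval (Env.cons i e)).1 := by
    simpa [Fml.Sat] using h
  rw [h']
  refine (eval_seqHead_le _ _).trans ((eval_seqDrop_le _ _ _).trans ?_)
  rw [Term.eval_wk]

/-! ### Primitive recursive functions as terms -/

/-- Every primitive recursive function `f` is given by terms. Stating this for the values of
arbitrary terms `t`, rather than variables, makes composition immediate in the induction. -/
theorem exists_term_of_primrec {n : ℕ} {f : List.Vector ℕ n → ℕ} (hf : Nat.Primrec' f) {Γ : Ctx}
    (t : Fin n → Term Γ .nat) :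
    ∃ u : Term Γ .nat, ∀ e, (u.eval e).1 = f (List.Vector.ofFn fun i => ((t i).eval e).1) := by
  induction hf generalizing Γ with
  | zero => exact ⟨.zero, fun e => rfl⟩
  | succ => exact ⟨.app .succ (t 0), fun e => by simp⟩
  | get i => exact ⟨t i, fun e => by simp⟩
  | comp g _ _ ihf ihg =>
    choose u hu using fun i => ihg i t
    obtain ⟨w, hw⟩ := ihf u
    exact ⟨w, fun e => by simp [hw, hu]⟩
  | @prec n f g _ _ ihf ihg =>
    obtain ⟨u, hu⟩ := ihf fun i => t i.succ
    obtain ⟨w, hw⟩ := ihg (Γ := .nat :: .nat :: Γ)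
      (Fin.cons (.var .here) (Fin.cons (.var (.there .here)) fun i => ((t i.succ).wk _).wk _))
    refine ⟨natRec (t 0) u w.lam.lam, fun e => ?_⟩
    rw [eval_natRec]
    simp only [List.Vector.ofFn, List.Vector.head_cons, List.Vector.tail_cons, Term.eval_lam]
    induction ((t 0).eval e).1 with
    | zero => exact hu e
    | succ m ih => simp [hw, ih, List.Vector.ofFn]

/-! ### A formula without bounded choice function -/

/-- The characteristic function of "the program with code `x` halts on input `0` within `z`
steps". -/
def haltsWithin (x z : ℕ) : ℕ :=
  if (Nat.Partrec.Code.evaln z (Denumerable.ofNat Nat.Partrec.Code x) 0).isSome then 1 else 0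

theorem haltsWithin_primrec : Primrec₂ haltsWithin :=
  Primrec.ite (Primrec.eq.comp (Primrec.option_isSome.comp
    (Nat.Partrec.Code.primrec_evaln.comp (Primrec.pair (Primrec.pair Primrec.snd
      ((Primrec.ofNat _).comp Primrec.fst)) (Primrec.const 0)))) (Primrec.const true))
    (Primrec.const 1) (Primrec.const 0)

theorem haltsWithin_mono {x z z' : ℕ} (h : z ≤ z') (hz : haltsWithin x z = 1) :
    haltsWithin x z' = 1 := by
  simp only [haltsWithin, Option.isSome_iff_exists, ite_eq_left_iff, zero_ne_one, imp_false,
    not_not] at hz ⊢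
  obtain ⟨v, hv⟩ := hz
  exact ⟨v, Nat.Partrec.Code.evaln_mono h hv⟩

theorem exists_haltsWithin_iff (x : ℕ) :
    (∃ z, haltsWithin x z = 1) ↔ ((Denumerable.ofNat Nat.Partrec.Code x).eval 0).Dom := by
  simp only [haltsWithin, Option.isSome_iff_exists, ite_eq_left_iff, zero_ne_one, imp_false,
    not_not, Part.dom_iff_mem, Nat.Partrec.Code.evaln_complete]
  exact exists_comm

/-- No computable function bounds the halting times. -/
theorem not_computable_of_bounds_halting {f : ℕ → ℕ}
    (h : ∀ x z, haltsWithin x z = 1 → haltsWithin x (f x) = 1) : ¬ Computable f := by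
  intro hf
  refine ComputablePred.halting_problem 0 (ComputablePred.computable_iff.2
    ⟨fun c => haltsWithin (Encodable.encode c) (f (Encodable.encode c)) == 1, ?_, ?_⟩)
  · exact (Primrec.beq (α := ℕ)).to_comp.comp (haltsWithin_primrec.to_comp.comp Computable.encode
      (hf.comp Computable.encode)) (Computable.const 1)
  · funext c
    have := exists_haltsWithin_iff (Encodable.encode c)
    rw [Denumerable.ofNat_encode] at this
    simp only [beq_iff_eq, eq_iff_iff, ← this]
    exact ⟨fun ⟨z, hz⟩ => h _ z hz, fun hz => ⟨_, hz⟩⟩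

theorem D.computable_app (f : D (.nat ↣ .nat)) :
    Computable fun n => (f.app (D.ofNat n)).1 :=
  (ap_partrec.comp (Computable.const f.1) Computable.id).of_eq fun n => D.ap_eq f (D.ofNat n)

end EPAomega

theorem mainTheorem12 :
    ∃ φ : EPAomega.Fml [EPAomega.FType.nat, EPAomega.FType.nat],
      ¬ EPAomega.Provable (EPAomega.herbrandChoice φ) := by
  open EPAomega in
  have hprim : Nat.Primrec' fun v : List.Vector ℕ 2 => haltsWithin v.head v.tail.head :=
    Nat.Primrec'.of_prim (haltsWithin_primrec.comp Primrec.vector_head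
      (Primrec.vector_head.comp Primrec.vector_tail))
  -- In the context `z, y, x` (innermost first), `u` has the value `haltsWithin x z`, and `w` has
  -- the value `haltsWithin x y`.
  obtain ⟨u, hu⟩ := exists_term_of_primrec hprim (Γ := [.nat, .nat, .nat])
    ![.var (.there (.there .here)), .var .here]
  obtain ⟨w, hw⟩ := exists_term_of_primrec hprim (Γ := [.nat, .nat, .nat])
    ![.var (.there (.there .here)), .var (.there .here)]
  let φ : Fml [.nat, .nat] :=
    .all .nat ((Fml.eq u (.app .succ .zero)).imp (.eq w (.app .succ .zero)))
  have hφ (e : Env []) (x y : D .nat) : φ.Sat (Env.cons y (Env.cons x e)) ↔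
      ∀ z, haltsWithin x.1 z = 1 → haltsWithin x.1 y.1 = 1 := by
    simp only [φ, Fml.Sat, hu, hw]
    exact ⟨fun h z => by simpa [List.Vector.ofFn] using h (D.ofNat z),
      fun h z => by simpa [List.Vector.ofFn] using h z.1⟩
  refine ⟨φ, fun hprov => ?_⟩
  let e : Env [] := fun _ v => nomatch v
  obtain ⟨f, hf⟩ := hprov.sat e (by simp) fun x => by
    by_cases hx : ∃ z, haltsWithin x.1 z = 1
    · obtain ⟨z, hz⟩ := hx
      exact ⟨D.ofNat z, (hφ _ _ _).2 fun _ _ => hz⟩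
    · exact ⟨D.ofNat 0, (hφ _ _ _).2 fun z hz => (hx ⟨z, hz⟩).elim⟩
  refine not_computable_of_bounds_halting (fun x z hz => ?_) f.computable_app
  obtain ⟨y, hy, hxy⟩ := hf (D.ofNat x)
  rw [Fml.addOuter, Fml.sat_subst, Sub.eval_cons, Sub.eval_cons] at hxy
  exact haltsWithin_mono (le_of_sat_mem hy) ((hφ _ _ _).1 hxy z hz)
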